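/- Let $(X,d)$ be a proper geodesic Gromov hyperbolic metric space with Gromov boundary $\partial_G X$ and Gromov compactification $\overline X^G = X\sqcup\partial_G X$, and let $f\colon X\to X$ be a non-expanding map, i.e. $d(f(x),f(y))\le d(x,y)$ for all $x,y\in X$. For $\eta\in\partial_G X$ and $p\in X$ the dilation $\lambda_{\eta,p}(f)\in(0,+\infty]$ is defined by $\log\lambda_{\eta,p}(f)=\liminf_{z\to\eta}\big(d(z,p)-d(f(z),p)\big)$. The point $\eta$ is a boundary regular fixed point (BRFP) of $f$ if $\lambda_{\eta,p}(f)<+\infty$ for every $p\in X$ (equivalently, for one $p\in X$) and $f$ has geodesic limit $\eta$ at $\eta$, i.e. $f(z_n)\to\eta$ for every sequence $(z_n)$ in $X$ that converges to $\eta$ and is contained in some region $\{z\in X: d(z,\gamma)<R\}$, where $R>0$ and $\gamma$ is a geodesic ray with endpoint $\eta$. The stable dilation $\Lambda_\eta$ of $f$ at a BRFP $\eta$ is defined by $\log\Lambda_\eta=\lim_{n\to\infty}\frac1n\log\lambda_{\eta,p}(f^n)$, where $p\in X$ is arbitrary. A backward orbit of $f$ is a sequence $(x_n)_{n\ge0}$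 in $X$ with $f(x_{n+1})=x_n$ for all $n\ge 0$; it has bounded step if $\sup_n d(x_n,x_{n+1})<+\infty$. In this case let $\sigma_m(x_n)=\lim_{n\to\infty}d(x_{n+m},x_n)$ for $m\ge1$, and define the backward step rate $b(x_n)=\lim_{m\to\infty}\sigma_m(x_n)/m$. Let $(x_n)$ be a backward orbit of $f$ with bounded step and let $\eta\in\partial_G X$ be a limit point of $(x_n)$, i.e. the limit in $\overline X^G$ of some subsequence of $(x_n)$. Then $\eta$ is a BRFP of $f$; the limits defining $\log\Lambda_\eta$ (which is independent of $p$), $\sigma_m(x_n)$ ($m\ge 1$) and $b(x_n)$ exist and are finite; and $$0\le\log\Lambda_\eta\le b(x_n).$$ -/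

import Mathlib

open Filter Topology
open scoped NNReal

namespace GromovDynamics

section Geometry

/-- `S` is (the image of) a geodesic segment joining `x` to `y`. -/
def IsGeodesicSegment {X : Type*} [MetricSpace X] (x y : X) (S : Set X) : Prop :=
  ∃ γ : ℝ → X, γ 0 = x ∧ γ (dist x y) = y ∧
    (∀ s ∈ Set.Icc 0 (dist x y), ∀ t ∈ Set.Icc 0 (dist x y), dist (γ s) (γ t) = |s - t|) ∧
    S = γ '' Set.Icc 0 (dist x y)

/-- `X` is a geodesic metric space: any two points are joined by a geodesic segment. -/
def IsGeodesicSpace (X : Type*) [MetricSpace X] : Prop :=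
  ∀ x y : X, ∃ S : Set X, IsGeodesicSegment x y S

/-- Every geodesic triangle is `δ`-slim: each side is contained in the `δ`-neighbourhood of the
union of the other two. (Cyclic permutations of `x, y, z` give the statement for all sides.) -/
def IsDeltaHyperbolic (X : Type*) [MetricSpace X] (δ : ℝ) : Prop :=
  ∀ (x y z : X) (S₁ S₂ S₃ : Set X), IsGeodesicSegment x y S₁ → IsGeodesicSegment y z S₂ →
    IsGeodesicSegment z x S₃ → S₁ ⊆ Metric.thickening δ (S₂ ∪ S₃)

/-- `X` is Gromov hyperbolic: it is `δ`-hyperbolic for some `δ > 0`. -/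
def IsGromovHyperbolic (X : Type*) [MetricSpace X] : Prop :=
  ∃ δ : ℝ, 0 < δ ∧ IsDeltaHyperbolic X δ

/-- A geodesic ray: an isometric embedding of `[0, ∞)` into `X`. -/
structure GeodesicRay (X : Type*) [MetricSpace X] where
  toFun : ℝ≥0 → X
  isometry : Isometry toFun

/-- Two rays are asymptotic if they stay at bounded distance from each other. -/
def GeodesicRay.Asymptotic {X : Type*} [MetricSpace X] (γ σ : GeodesicRay X) : Prop :=
  ∃ K : ℝ, ∀ t : ℝ≥0, dist (γ.toFun t) (σ.toFun t) ≤ K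

theorem GeodesicRay.asymptotic_equivalence (X : Type*) [MetricSpace X] :
    Equivalence (GeodesicRay.Asymptotic (X := X)) where
  refl γ := ⟨0, fun t => by simp⟩
  symm := fun ⟨K, h⟩ => ⟨K, fun t => by rw [dist_comm]; exact h t⟩
  trans := fun ⟨K, h⟩ ⟨L, k⟩ =>
    ⟨K + L, fun t => (dist_triangle _ _ _).trans (add_le_add (h t) (k t))⟩

/-- The setoid of geodesic rays up to asymptoticity. -/
def GeodesicRay.setoid (X : Type*) [MetricSpace X] : Setoid (GeodesicRay X) :=
  ⟨GeodesicRay.Asymptotic, GeodesicRay.asymptotic_equivalence X⟩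

/-- The Gromov boundary: geodesic rays up to asymptoticity. -/
def GromovBoundary (X : Type*) [MetricSpace X] : Type _ :=
  Quotient (GeodesicRay.setoid X)

/-- The endpoint at infinity of a geodesic ray. -/
def GeodesicRay.endpoint {X : Type*} [MetricSpace X] (γ : GeodesicRay X) : GromovBoundary X :=
  Quotient.mk (GeodesicRay.setoid X) γ

/-- The Gromov compactification as a set: the disjoint union of `X` and its Gromov boundary. -/
inductive GromovCompactification (X : Type*) [MetricSpace X] where
  | ofPoint : X → GromovCompactification X
  | ofBoundary : GromovBoundary X → GromovCompactification X

open GromovCompactification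

/-- The Gromov product of `x` and `y` with respect to `w`. -/
noncomputable def gromovProduct {X : Type*} [MetricSpace X] (w x y : X) : ℝ :=
  (dist x w + dist y w - dist x y) / 2

/-- The points of the compactification whose Gromov product with `η` (based at `p`) is at
least `r`. -/
def boundaryNhd {X : Type*} [MetricSpace X] (p : X) (η : GromovBoundary X) (r : ℝ) :
    Set (GromovCompactification X) :=
  {y | match y with
    | ofPoint x => ∀ γ : GeodesicRay X, γ.endpoint = η →
        ∀ᶠ t in atTop, r ≤ gromovProduct p x (γ.toFun t)
    | ofBoundary ξ => ∀ γ σ : GeodesicRay X, γ.endpoint = η → σ.endpoint = ξ →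
        ∀ᶠ q : ℝ≥0 × ℝ≥0 in atTop, r ≤ gromovProduct p (σ.toFun q.1) (γ.toFun q.2)}

/-- The system of neighbourhoods defining the topology of the Gromov compactification: metric
neighbourhoods at points of `X`, and sets of points with large Gromov product with `η` at
a boundary point `η`. -/
def gromovNhds {X : Type*} [MetricSpace X] :
    GromovCompactification X → Filter (GromovCompactification X)
  | ofPoint x => map ofPoint (𝓝 x)
  | ofBoundary η => ⨅ (p : X) (r : ℝ), 𝓟 (boundaryNhd p η r)

/-- The topology of the Gromov compactification. -/
instance {X : Type*} [MetricSpace X] : TopologicalSpace (GromovCompactification X) :=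
  TopologicalSpace.mkOfNhds gromovNhds

theorem fourPoint {X : Type*} [MetricSpace X] {δ : ℝ} (hg : IsGeodesicSpace X)
    (hδ : IsDeltaHyperbolic X δ) (w x y z : X) :
    min (gromovProduct w x z) (gromovProduct w z y) - 3 * δ ≤ gromovProduct w x y := by
  have symm : ∀ {a b : X} {S : Set X}, IsGeodesicSegment a b S → IsGeodesicSegment b a S := by
    rintro a b S ⟨γ, h0, h1, hi, rfl⟩
    refine ⟨fun t => γ (dist a b - t), by simpa using h1, by simpa [dist_comm b a] using h0, ?_, ?_⟩
    · intro s hs t ht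
      rw [dist_comm b a] at hs ht
      rw [hi _ ⟨by linarith [hs.2], by linarith [hs.1]⟩ _ ⟨by linarith [ht.2], by linarith [ht.1]⟩,
        abs_sub_comm]
      congr 1; ring
    · rw [dist_comm b a]
      ext u; constructor
      · rintro ⟨t, ht, rfl⟩
        exact ⟨dist a b - t, ⟨by linarith [ht.2], by linarith [ht.1]⟩, by simp⟩
      · rintro ⟨t, ht, rfl⟩
        exact ⟨dist a b - t, ⟨by linarith [ht.2], by linarith [ht.1]⟩, rfl⟩
  have add : ∀ {a b : X} {S : Set X}, IsGeodesicSegment a b S → ∀ u ∈ S,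
      dist a u + dist u b = dist a b := by
    rintro a b S ⟨γ, h0, h1, hi, rfl⟩ _ ⟨t, ht, rfl⟩
    have e1 := hi 0 ⟨le_rfl, dist_nonneg⟩ t ht
    have e2 := hi t ht (dist a b) ⟨dist_nonneg, le_rfl⟩
    rw [h0, abs_sub_comm, abs_of_nonneg (by linarith [ht.1])] at e1
    rw [h1, abs_sub_comm, abs_of_nonneg (by linarith [ht.2])] at e2
    linarith
  have ends : ∀ {a b : X} {S : Set X}, IsGeodesicSegment a b S → a ∈ S ∧ b ∈ S := by
    rintro a b S ⟨γ, h0, h1, hi, rfl⟩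
    exact ⟨⟨0, ⟨le_rfl, dist_nonneg⟩, h0⟩, ⟨_, ⟨dist_nonneg, le_rfl⟩, h1⟩⟩
  have conn : ∀ {a b : X} {S : Set X}, IsGeodesicSegment a b S → IsPreconnected S := by
    rintro a b S ⟨γ, h0, h1, hi, rfl⟩
    refine isPreconnected_Icc.image _ ?_
    have : LipschitzOnWith 1 γ (Set.Icc 0 (dist a b)) :=
      LipschitzOnWith.of_dist_le_mul fun s hs t ht => by
        simp [hi s hs t ht, Real.dist_eq]
    exact this.continuousOn
  obtain ⟨S, hS⟩ := hg x y
  obtain ⟨A, hA⟩ := hg y w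
  obtain ⟨B, hB⟩ := hg w x
  obtain ⟨C, hC⟩ := hg y z
  obtain ⟨D, hD⟩ := hg z x
  have hδ0 : 0 < δ := by
    have := hδ x y z S C D hS hC hD (ends hS).1
    obtain ⟨v, -, hv⟩ := Metric.mem_thickening_iff.1 this
    exact dist_nonneg.trans_lt hv
  have cov := hδ x y w S A B hS hA hB
  rw [Metric.thickening_union] at cov
  obtain ⟨u, huS, huA, huB⟩ := conn hS _ _ Metric.isOpen_thickening Metric.isOpen_thickening cov
    ⟨y, (ends hS).2, Metric.self_subset_thickening hδ0 _ (ends hA).1⟩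
    ⟨x, (ends hS).1, Metric.self_subset_thickening hδ0 _ (ends hB).2⟩
  obtain ⟨a, haA, ha⟩ := Metric.mem_thickening_iff.1 huA
  obtain ⟨b, hbB, hb⟩ := Metric.mem_thickening_iff.1 huB
  have key : dist w u ≤ gromovProduct w x y + 2 * δ := by
    have h1 := add hA a haA
    have h2 := add hB b hbB
    have h3 := add hS u huS
    have := dist_triangle w a u
    have := dist_triangle w b u
    have := dist_triangle y a u
    have := dist_triangle u b x
    unfold gromovProduct
    simp only [dist_comm] at *
    linarith
  have low : ∀ {c d : X} {S : Set X}, IsGeodesicSegment c d S → ∀ v ∈ S,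
      gromovProduct w c d ≤ dist w v := by
    intro c d S hS v hv
    have := add hS v hv
    have h1 := dist_triangle c v w
    have h2 := dist_triangle d v w
    unfold gromovProduct
    rw [dist_comm w v]
    rw [dist_comm v d] at this
    linarith
  obtain ⟨v, hv, huv⟩ := Metric.mem_thickening_iff.1 (hδ x y z S C D hS hC hD huS)
  have hwv := dist_triangle w u v
  rcases hv with hv | hv
  · have := low (symm hC) v hv
    have := min_le_right (gromovProduct w x z) (gromovProduct w z y)
    linarith
  · have := low (symm hD) v hv
    have := min_le_left (gromovProduct w x z) (gromovProduct w z y)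
    linarith

theorem gromovProduct_comm {X : Type*} [MetricSpace X] (w x y : X) :
    gromovProduct w x y = gromovProduct w y x := by
  simp only [gromovProduct, dist_comm x y]; ring

theorem boundaryNhd_base {X : Type*} [MetricSpace X] (p q : X) (η : GromovBoundary X) (r : ℝ) :
    boundaryNhd p η (r + dist p q) ⊆ boundaryNhd q η r := by
  have key : ∀ a b : X, r + dist p q ≤ gromovProduct p a b → r ≤ gromovProduct q a b := by
    intro a b h
    have h1 := dist_triangle a q p
    have h2 := dist_triangle b q p
    unfold gromovProduct at *
    rw [dist_comm q p] at h1 h2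
    linarith
  rintro (x | ξ) h
  · exact fun γ hγ => (h γ hγ).mono fun t => key _ _
  · exact fun γ σ hγ hσ => (h γ σ hγ hσ).mono fun t => key _ _

theorem boundaryNhd_anti {X : Type*} [MetricSpace X] (p : X) (η : GromovBoundary X) {r s : ℝ}
    (hrs : r ≤ s) : boundaryNhd p η s ⊆ boundaryNhd p η r := by
  rintro (x | ξ) h
  · exact fun γ hγ => (h γ hγ).mono fun t => hrs.trans
  · exact fun γ σ hγ hσ => (h γ σ hγ hσ).mono fun t => hrs.trans

theorem mem_boundaryNhd_self {X : Type*} [MetricSpace X] (p : X) (η : GromovBoundary X) (r : ℝ) :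
    ofBoundary η ∈ boundaryNhd p η r := by
  intro γ σ hγ hσ
  obtain ⟨K, hK⟩ : σ.Asymptotic γ :=
    Quotient.exact (s := GeodesicRay.setoid X) (hσ.trans hγ.symm)
  obtain ⟨T, hT⟩ : ∃ T : ℝ≥0, r + K + dist p (σ.toFun 0) + dist p (γ.toFun 0) ≤ T :=
    ⟨Real.toNNReal _, Real.le_coe_toNNReal _⟩
  have hK0 : 0 ≤ K := dist_nonneg.trans (hK 0)
  filter_upwards [eventually_ge_atTop (T, T)] with ⟨s, t⟩ ⟨hs, ht⟩
  have hs' : (T : ℝ) ≤ s := hs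
  have ht' : (T : ℝ) ≤ t := ht
  have e1 := σ.isometry.dist_eq s 0
  have e2 := γ.isometry.dist_eq t 0
  have e3 := γ.isometry.dist_eq s t
  rw [NNReal.dist_eq] at e1 e2 e3
  simp only [NNReal.coe_zero, sub_zero, NNReal.abs_eq] at e1 e2
  have h1 := dist_triangle (σ.toFun s) p (σ.toFun 0)
  have h2 := dist_triangle (γ.toFun t) p (γ.toFun 0)
  have h3 := dist_triangle (σ.toFun s) (γ.toFun s) (γ.toFun t)
  have h4 := hK s
  have h5 : (0 : ℝ) ≤ dist p (σ.toFun 0) := dist_nonneg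
  have h6 : (0 : ℝ) ≤ dist p (γ.toFun 0) := dist_nonneg
  simp only [gromovProduct]
  rcases abs_cases ((s : ℝ) - t) with ⟨h, -⟩ | ⟨h, -⟩ <;> linarith

theorem hasBasis_gromovNhds {X : Type*} [MetricSpace X] (p : X) (η : GromovBoundary X) :
    (gromovNhds (ofBoundary η)).HasBasis (fun _ : ℝ => True) (boundaryNhd p η) := by
  have h : gromovNhds (ofBoundary η) = ⨅ r : ℝ, 𝓟 (boundaryNhd p η r) := by
    refine le_antisymm (iInf_le _ p) (le_iInf fun q => le_iInf fun r => ?_)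
    exact (iInf_le _ (r + dist p q)).trans (principal_mono.2 (boundaryNhd_base p q η r))
  rw [h]
  refine hasBasis_iInf_principal fun r s => ⟨max r s, ?_, ?_⟩
  · exact boundaryNhd_anti p η (le_max_left _ _)
  · exact boundaryNhd_anti p η (le_max_right _ _)

/-- On a Gromov hyperbolic geodesic space the prescribed neighbourhoods are the neighbourhoods of
the topology. -/
theorem nhds_eq_gromovNhds {X : Type*} [MetricSpace X] (hg : IsGeodesicSpace X)
    (hX : IsGromovHyperbolic X) (y : GromovCompactification X) : 𝓝 y = gromovNhds y := by
  obtain ⟨δ, hδ0, hδ⟩ := hX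
  refine TopologicalSpace.nhds_mkOfNhds gromovNhds y ?_ ?_
  · rintro (x | η)
    · intro s hs
      have hs' : ofPoint ⁻¹' s ∈ 𝓝 x := hs
      exact (mem_of_mem_nhds hs' : x ∈ ofPoint ⁻¹' s)
    · exact le_iInf fun p => le_iInf fun r => by
        simpa using mem_boundaryNhd_self p η r
  · rintro (x | η) s hs
    · have hs' : ofPoint ⁻¹' s ∈ 𝓝 x := hs
      exact eventually_map.2 (eventually_mem_nhds_iff.2 hs')
    · obtain ⟨γ₀, rfl⟩ := Quotient.exists_rep (s := GeodesicRay.setoid X) η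
      set η := Quotient.mk (GeodesicRay.setoid X) γ₀
      let p := γ₀.toFun 0
      obtain ⟨r, -, hr⟩ := (hasBasis_gromovNhds p η).mem_iff.1 hs
      refine (hasBasis_gromovNhds p η).eventually_iff.2 ⟨max (r + 1) (r + 3 * δ), trivial, ?_⟩
      rintro (x | ξ) h
      · replace h := boundaryNhd_anti p η (le_max_left _ _) h
        refine mem_of_superset (image_mem_map (Metric.ball_mem_nhds x one_pos)) ?_
        rintro _ ⟨x', hx', rfl⟩
        refine hr fun γ hγ => (h γ hγ).mono fun t ht => ?_
        have h1 := dist_triangle x x' p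
        have h2 := dist_triangle x' x (γ.toFun t)
        rw [Metric.mem_ball] at hx'
        unfold gromovProduct at *
        rw [dist_comm x x'] at h1
        linarith
      · replace h := boundaryNhd_anti p η (le_max_right _ _) h
        refine (hasBasis_gromovNhds p ξ).mem_iff.2 ⟨r + 3 * δ, trivial, fun z hz => hr ?_⟩
        obtain ⟨σ, hσ⟩ := Quotient.exists_rep (s := GeodesicRay.setoid X) ξ
        rcases z with x | ζ
        · intro γ hγ
          obtain ⟨a, ha⟩ := eventually_atTop.1 (hz σ hσ)
          obtain ⟨⟨b, c⟩, hb⟩ := eventually_atTop.1 (h γ σ hγ hσ)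
          filter_upwards [eventually_ge_atTop c] with t ht
          have h1 := ha (max a b) (le_max_left _ _)
          have h2 := hb (max a b, t) ⟨le_max_right _ _, ht⟩
          have h3 := fourPoint hg hδ p x (γ.toFun t) (σ.toFun (max a b))
          have := le_min h1 h2
          linarith
        · intro γ τ hγ hτ
          obtain ⟨⟨d, a⟩, ha⟩ := eventually_atTop.1 (hz σ τ hσ hτ)
          obtain ⟨⟨b, c⟩, hb⟩ := eventually_atTop.1 (h γ σ hγ hσ)
          filter_upwards [eventually_ge_atTop (d, c)] with ⟨u, t⟩ ⟨hu, ht⟩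
          have h1 := ha (u, max a b) ⟨hu, le_max_left _ _⟩
          have h2 := hb (max a b, t) ⟨le_max_right _ _, ht⟩
          have h3 := fourPoint hg hδ p (τ.toFun u) (γ.toFun t) (σ.toFun (max a b))
          have := le_min h1 h2
          simp only at *
          linarith

end Geometry

section Dynamics

open GromovCompactification

/-- The filter on `X` describing `z → η` in the Gromov compactification, with `z ∈ X`. -/
def approach {X : Type*} [MetricSpace X] (η : GromovBoundary X) : Filter X :=
  comap ofPoint (𝓝 (ofBoundary η))

/-- The geodesic region `A(γ, R)`: the open `R`-neighbourhood of the ray `γ`. -/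
def geodesicRegion {X : Type*} [MetricSpace X] (γ : GeodesicRay X) (R : ℝ) : Set X :=
  Metric.thickening R (Set.range γ.toFun)

/-- `g : X → Y` has geodesic limit `ξ` at `η`. -/
def HasGeodesicLimit {X Y : Type*} [MetricSpace X] [TopologicalSpace Y] (g : X → Y)
    (η : GromovBoundary X) (ξ : Y) : Prop :=
  ∀ u : ℕ → X, Tendsto (fun n => ofPoint (u n)) atTop (𝓝 (ofBoundary η)) →
    (∃ (γ : GeodesicRay X) (R : ℝ), γ.endpoint = η ∧ 0 < R ∧ ∀ n, u n ∈ geodesicRegion γ R) →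
    Tendsto (fun n => g (u n)) atTop (𝓝 ξ)

/-- The logarithm `log λ_{η,p}(f) = liminf_{z → η} (d(z, p) - d(f(z), p))` of the dilation of `f`
at `η` with respect to the base point `p`, as an extended real number. -/
noncomputable def logDilation {X : Type*} [MetricSpace X] (f : X → X) (η : GromovBoundary X)
    (p : X) : EReal :=
  liminf (fun z => ((dist z p - dist (f z) p : ℝ) : EReal)) (approach η)

/-- `η` is a boundary regular fixed point of `f`: its dilation is finite (with respect to one, or
equivalently every, base point) and `f` has geodesic limit `η` at `η`. -/
def IsBRFP {X : Type*} [MetricSpace X] (f : X → X) (η : GromovBoundary X) : Prop :=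
  (∀ p : X, logDilation f η p < ⊤) ∧ HasGeodesicLimit (fun z => ofPoint (f z)) η (ofBoundary η)

/-- The limit `lim_{n → ∞} log λ_{η,p}(f^n) / n` defining the logarithm of the stable dilation
`Λ_η` exists and equals the real number `L`, for every base point `p`. -/
def HasLogStableDilation {X : Type*} [MetricSpace X] (f : X → X) (η : GromovBoundary X)
    (L : ℝ) : Prop :=
  ∀ p : X, Tendsto (fun n : ℕ => logDilation (f^[n]) η p / (n : EReal)) atTop (𝓝 (L : EReal))

/-- `x` is a backward orbit of `f`. -/
def IsBackwardOrbit {X : Type*} (f : X → X) (x : ℕ → X) : Prop :=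
  ∀ n, f (x (n + 1)) = x n

/-- The sequence `x` has bounded step. -/
def HasBoundedStep {X : Type*} [MetricSpace X] (x : ℕ → X) : Prop :=
  ∃ K : ℝ, ∀ n, dist (x (n + 1)) (x n) ≤ K

/-- The limits `σ_m = lim_{n → ∞} d(x_{n+m}, x_n)`, `m ≥ 1`, and `b = lim_{m → ∞} σ_m / m` exist
(as real numbers); `b` is the backward step rate of `x`. -/
def HasBackwardStepRate {X : Type*} [MetricSpace X] (x : ℕ → X) (b : ℝ) : Prop :=
  ∃ σ : ℕ → ℝ, (∀ m, 1 ≤ m → Tendsto (fun n => dist (x (n + m)) (x n)) atTop (𝓝 (σ m))) ∧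
    Tendsto (fun m : ℕ => σ m / m) atTop (𝓝 b)

/-- The boundary point `η` is a limit point of the sequence `x`: some subsequence of `x` converges
to `η` in the Gromov compactification. -/
def IsBoundaryLimitPoint {X : Type*} [MetricSpace X] (x : ℕ → X) (η : GromovBoundary X) : Prop :=
  ∃ φ : ℕ → ℕ, StrictMono φ ∧ Tendsto (fun k => ofPoint (x (φ k))) atTop (𝓝 (ofBoundary η))

end Dynamics

end GromovDynamics

/-! Fix a ray `γ` ending at `η`, with origin `p` and Busemann function `β`. Since `d(z,p) - β(z)` is
twice the Gromov product of `z` with `η`, up to `O(δ)`, it detects convergence to `η`. A Julia-type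
lemma (`busemann_map_le`) bounds the increase of `β` under a non-expanding map `g` by `d(w,p) - d(g
w,p)`, up to `12δ`, for `w` and `g w` both tending to `η`. Hence `log λ` of `f^n` equals `S_n = sup
(β ∘ f^n - β)` up to an error independent of `n`; as `S_n` is exactly subadditive, `log Λ = lim S_n
/ n`.

Along the backward orbit `f^m` moves points by at most `σ_m`, so Julia's lemma gives `S_m ≤ σ_m +
12δ`. This yields the BRFP property and `log Λ ≤ b`. If `log Λ` were negative, some `f^N` would
lower `β` by at least `6δ` everywhere; by hyperbolicity, `d(x_n,p) - β(x_n)` would then be bounded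
along the backward orbit, which therefore could not accumulate at `η`. -/

namespace GromovDynamics

open GromovCompactification

/-! ### Busemann functions, convergence to the boundary, and dilation -/

section Busemann

variable {X : Type*} [MetricSpace X]

/-- The Busemann function of a geodesic ray. -/
noncomputable def GeodesicRay.busemann (γ : GeodesicRay X) (z : X) : ℝ :=
  ⨅ s : ℝ≥0, (dist z (γ.toFun s) - s)

theorem GeodesicRay.dist_apply (γ : GeodesicRay X) (s t : ℝ≥0) :
    dist (γ.toFun s) (γ.toFun t) = |(s : ℝ) - t| := by
  rw [γ.isometry.dist_eq, NNReal.dist_eq]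

theorem GeodesicRay.dist_zero_apply (γ : GeodesicRay X) (t : ℝ≥0) :
    dist (γ.toFun 0) (γ.toFun t) = t := by
  simp [γ.dist_apply]

theorem GeodesicRay.neg_dist_le (γ : GeodesicRay X) (z : X) (s : ℝ≥0) :
    -dist z (γ.toFun 0) ≤ dist z (γ.toFun s) - s := by
  have := dist_triangle_left (γ.toFun 0) (γ.toFun s) z
  rw [γ.dist_zero_apply] at this
  linarith

theorem GeodesicRay.tendsto_busemann (γ : GeodesicRay X) (z : X) :
    Tendsto (fun s : ℝ≥0 => dist z (γ.toFun s) - s) atTop (𝓝 (γ.busemann z)) := by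
  refine tendsto_atTop_ciInf (fun s t hst => ?_) ⟨-dist z (γ.toFun 0), ?_⟩
  · have hst' : (s : ℝ) ≤ t := hst
    have := dist_triangle z (γ.toFun s) (γ.toFun t)
    rw [γ.dist_apply, abs_sub_comm, abs_of_nonneg (by linarith)] at this
    linarith
  · rintro _ ⟨s, rfl⟩
    exact γ.neg_dist_le z s

theorem GeodesicRay.neg_dist_le_busemann (γ : GeodesicRay X) (z : X) :
    -dist z (γ.toFun 0) ≤ γ.busemann z :=
  le_ciInf fun s => γ.neg_dist_le z s

theorem GeodesicRay.busemann_le_add_dist (γ : GeodesicRay X) (z w : X) :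
    γ.busemann z ≤ γ.busemann w + dist z w := by
  refine le_of_tendsto_of_tendsto' (γ.tendsto_busemann z)
    ((γ.tendsto_busemann w).add_const (dist z w)) fun s => ?_
  have := dist_triangle z w (γ.toFun s)
  linarith

theorem GeodesicRay.busemann_apply (γ : GeodesicRay X) (t : ℝ≥0) :
    γ.busemann (γ.toFun t) = -t := by
  refine tendsto_nhds_unique (γ.tendsto_busemann _) (tendsto_const_nhds.congr' ?_)
  filter_upwards [eventually_ge_atTop t] with s hs
  have hs' : (t : ℝ) ≤ s := hs
  rw [γ.dist_apply, abs_sub_comm, abs_of_nonneg (by linarith)]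
  ring

theorem GeodesicRay.busemann_zero (γ : GeodesicRay X) : γ.busemann (γ.toFun 0) = 0 := by
  simp [γ.busemann_apply]

/-- The four-point inequality with the fourth point sent to infinity along `γ`; this is how
hyperbolicity enters the later estimates on `β`. -/
theorem GeodesicRay.busemann_fourPoint {δ : ℝ} (hg : IsGeodesicSpace X)
    (hδ : IsDeltaHyperbolic X δ) (γ : GeodesicRay X) (a b c : X) :
    dist a b + γ.busemann c ≤
      max (dist a c + γ.busemann b) (dist b c + γ.busemann a) + 6 * δ := by
  refine le_of_tendsto_of_tendsto' ((γ.tendsto_busemann c).const_add (dist a b))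
    ((((γ.tendsto_busemann b).const_add (dist a c)).max
      ((γ.tendsto_busemann a).const_add (dist b c))).add_const (6 * δ)) fun s => ?_
  have h := fourPoint hg hδ (γ.toFun s) a b c
  unfold gromovProduct at h
  rw [dist_comm c b] at h
  rcases min_le_iff.1 (sub_le_iff_le_add.1 h) with h | h
  · have := le_max_right (dist a c + (dist b (γ.toFun s) - s)) (dist b c + (dist a (γ.toFun s) - s))
    have := le_max_left (dist a c + (dist b (γ.toFun s) - s)) (dist b c + (dist a (γ.toFun s) - s))
    linarith
  · have := le_max_right (dist a c + (dist b (γ.toFun s) - s)) (dist b c + (dist a (γ.toFun s) - s))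
    linarith

theorem GeodesicRay.tendsto_gromovProduct (γ : GeodesicRay X) (z : X) :
    Tendsto (fun s : ℝ≥0 => gromovProduct (γ.toFun 0) z (γ.toFun s)) atTop
      (𝓝 ((dist z (γ.toFun 0) - γ.busemann z) / 2)) := by
  refine (((γ.tendsto_busemann z).const_sub (dist z (γ.toFun 0))).div_const 2).congr fun s => ?_
  rw [gromovProduct, dist_comm (γ.toFun s), γ.dist_zero_apply]
  ring

/-- A point with large Busemann-type Gromov product with `η` lies in the corresponding
neighbourhood of `η`. -/
theorem ofPoint_mem_boundaryNhd {δ : ℝ} (hg : IsGeodesicSpace X)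
    (hδ : IsDeltaHyperbolic X δ) (γ : GeodesicRay X) {z : X} {r : ℝ}
    (h : r + 3 * δ < (dist z (γ.toFun 0) - γ.busemann z) / 2) :
    ofPoint z ∈ boundaryNhd (γ.toFun 0) γ.endpoint r := by
  intro σ hσ
  obtain ⟨K, hK⟩ : σ.Asymptotic γ := Quotient.exact (s := GeodesicRay.setoid X) hσ
  filter_upwards [(γ.tendsto_gromovProduct z).eventually_const_lt h,
    eventually_ge_atTop (Real.toNNReal (r + 3 * δ + K))] with s h1 hs
  have hs' : r + 3 * δ + K ≤ s := Real.toNNReal_le_iff_le_coe.1 hs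
  refine le_trans ?_ (fourPoint hg hδ (γ.toFun 0) z (σ.toFun s) (γ.toFun s))
  -- Asymptotic rays have Gromov product at least `s - K` at time `s`, so `σ` may replace `γ` at the
  -- cost of one `3δ`.
  have h2 : r + 3 * δ ≤ gromovProduct (γ.toFun 0) (γ.toFun s) (σ.toFun s) := by
    have h3 := hK s
    have h4 := dist_triangle_left (γ.toFun 0) (γ.toFun s) (σ.toFun s)
    have h5 := γ.dist_zero_apply s
    rw [gromovProduct, dist_comm (γ.toFun s) (γ.toFun 0), dist_comm (γ.toFun s) (σ.toFun s)]
    linarith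
  have := le_min h1.le h2
  linarith

/-- Convergence to `γ(∞)` is detected by the Busemann function of `γ`. -/
theorem approach_eq_comap {δ : ℝ} (hg : IsGeodesicSpace X) (hδ0 : 0 < δ)
    (hδ : IsDeltaHyperbolic X δ) (γ : GeodesicRay X) :
    approach γ.endpoint = comap (fun z => dist z (γ.toFun 0) - γ.busemann z) atTop := by
  rw [approach, nhds_eq_gromovNhds hg ⟨δ, hδ0, hδ⟩]
  refine ((hasBasis_gromovNhds (γ.toFun 0) γ.endpoint).comap ofPoint).ext
    (atTop_basis.comap _) (fun r _ => ?_) fun r _ => ?_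
  · refine ⟨2 * (r + 3 * δ) + 1, trivial, fun z hz => ofPoint_mem_boundaryNhd hg hδ γ ?_⟩
    have : 2 * (r + 3 * δ) + 1 ≤ dist z (γ.toFun 0) - γ.busemann z := hz
    linarith
  · refine ⟨r / 2, trivial, fun z hz => ?_⟩
    have := ge_of_tendsto (γ.tendsto_gromovProduct z) (hz γ rfl)
    show r ≤ dist z (γ.toFun 0) - γ.busemann z
    linarith

theorem tendsto_approach_iff {δ : ℝ} (hg : IsGeodesicSpace X) (hδ0 : 0 < δ)
    (hδ : IsDeltaHyperbolic X δ) (γ : GeodesicRay X) {ι : Type*} {l : Filter ι} {u : ι → X} :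
    Tendsto u l (approach γ.endpoint) ↔
      Tendsto (fun i => dist (u i) (γ.toFun 0) - γ.busemann (u i)) l atTop := by
  rw [approach_eq_comap hg hδ0 hδ, tendsto_comap_iff]; rfl

/-- For `w` close enough to `η`, depending on `z`, the normalized distance to `w` approximates `β`.
The hypothesis excludes the wrong branch of the maximum in both four-point inequalities. -/
theorem abs_dist_sub_busemann_le {δ : ℝ} (hg : IsGeodesicSpace X)
    (hδ : IsDeltaHyperbolic X δ) (γ : GeodesicRay X) {z w : X}
    (h : 2 * dist z (γ.toFun 0) + 6 * δ < dist w (γ.toFun 0) - γ.busemann w) :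
    |dist z w - dist w (γ.toFun 0) - γ.busemann z| ≤ 6 * δ := by
  have h1 := γ.busemann_fourPoint hg hδ z w (γ.toFun 0)
  have h2 := γ.busemann_fourPoint hg hδ (γ.toFun 0) w z
  have h3 := dist_triangle_left w (γ.toFun 0) z
  have h4 := γ.neg_dist_le_busemann z
  rw [γ.busemann_zero] at h1 h2
  rw [dist_comm (γ.toFun 0) w, dist_comm (γ.toFun 0) z, dist_comm w z] at h2
  rw [abs_le]
  constructor
  · rcases le_max_iff.1 (sub_le_iff_le_add.2 h2) with h | h <;> linarith
  · rcases le_max_iff.1 (sub_le_iff_le_add.2 h1) with h | h <;> linarith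

/-- A Julia-type lemma. -/
theorem busemann_map_le {δ : ℝ} (hg : IsGeodesicSpace X) (hδ0 : 0 < δ)
    (hδ : IsDeltaHyperbolic X δ) (γ : GeodesicRay X) {g : X → X} (hLip : LipschitzWith 1 g)
    {l : Filter X} [l.NeBot] (hl : l ≤ approach γ.endpoint)
    (hgl : Tendsto g l (approach γ.endpoint)) {A : ℝ}
    (hA : ∀ᶠ w in l, dist w (γ.toFun 0) - dist (g w) (γ.toFun 0) ≤ A) (z : X) :
    γ.busemann (g z) ≤ γ.busemann z + A + 12 * δ := by
  have h1 := ((tendsto_approach_iff hg hδ0 hδ γ (u := id)).1 hl).eventually_gt_atTop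
    (2 * dist z (γ.toFun 0) + 6 * δ)
  have h2 := ((tendsto_approach_iff hg hδ0 hδ γ).1 hgl).eventually_gt_atTop
    (2 * dist (g z) (γ.toFun 0) + 6 * δ)
  obtain ⟨w, hw1, hw2, hw⟩ := (h1.and (h2.and hA)).exists
  have h3 := (abs_le.1 (abs_dist_sub_busemann_le hg hδ γ hw1)).2
  have h4 := (abs_le.1 (abs_dist_sub_busemann_le hg hδ γ hw2)).1
  have h5 := hLip.dist_le_mul z w
  simp only [id, NNReal.coe_one, one_mul] at *
  linarith

theorem GeodesicRay.tendsto_approach {δ : ℝ} (hg : IsGeodesicSpace X) (hδ0 : 0 < δ)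
    (hδ : IsDeltaHyperbolic X δ) (γ : GeodesicRay X) :
    Tendsto γ.toFun atTop (approach γ.endpoint) := by
  rw [tendsto_approach_iff hg hδ0 hδ]
  refine tendsto_atTop_mono (fun t => ?_) (NNReal.tendsto_coe_atTop.2 tendsto_id)
  rw [dist_comm, γ.dist_zero_apply, γ.busemann_apply]
  have := t.coe_nonneg
  simp only [id]
  linarith

/-- It suffices to test the liminf on `γ` itself, where `d(γ t, p) = -β(γ t)`, while `d(g(γ t), p) ≥
-β(g(γ t))`. Changing base point costs the remaining term. -/
theorem logDilation_le {δ : ℝ} (hg : IsGeodesicSpace X) (hδ0 : 0 < δ)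
    (hδ : IsDeltaHyperbolic X δ) (γ : GeodesicRay X) {g : X → X} {S : ℝ}
    (hS : ∀ z, γ.busemann (g z) - γ.busemann z ≤ S) (q : X) :
    logDilation g γ.endpoint q ≤ ((S + 2 * dist (γ.toFun 0) q : ℝ) : EReal) := by
  refine liminf_le_of_frequently_le
    ((γ.tendsto_approach hg hδ0 hδ).frequently (Frequently.of_forall fun t => ?_))
  rw [EReal.coe_le_coe_iff]
  have h1 := dist_triangle (γ.toFun t) (γ.toFun 0) q
  have h2 := dist_triangle_right (g (γ.toFun t)) (γ.toFun 0) q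
  have h3 := hS (γ.toFun t)
  have h4 := γ.neg_dist_le_busemann (g (γ.toFun t))
  rw [dist_comm (γ.toFun t) (γ.toFun 0), γ.dist_zero_apply] at h1
  rw [γ.busemann_apply] at h3
  linarith

/-- A smaller liminf would, through Julia's lemma, give an upper bound for the increase of `β` that
is below `S`. -/
theorem le_logDilation {δ : ℝ} (hg : IsGeodesicSpace X) (hδ0 : 0 < δ)
    (hδ : IsDeltaHyperbolic X δ) (γ : GeodesicRay X) {g : X → X} (hLip : LipschitzWith 1 g)
    {B S : ℝ} (hB : ∀ z, γ.busemann (g z) - γ.busemann z ≤ B)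
    (hS : ∀ B', (∀ z, γ.busemann (g z) - γ.busemann z ≤ B') → S ≤ B') (q : X) :
    ((S - (12 * δ + 2 * dist (γ.toFun 0) q) : ℝ) : EReal) ≤ logDilation g γ.endpoint q := by
  by_contra! hlt
  obtain ⟨A, hA1, hA2⟩ := EReal.lt_iff_exists_real_btwn.1 hlt
  have hfr := frequently_lt_of_liminf_lt (h := hA1)
  set D := dist (γ.toFun 0) q
  let T : Set X := {z | dist z (γ.toFun 0) - dist (g z) (γ.toFun 0) ≤ A + 2 * D}
  have hT : ∃ᶠ z in approach γ.endpoint, z ∈ T := hfr.mono fun z hz => by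
    rw [EReal.coe_lt_coe_iff] at hz
    have h1 := dist_triangle_right z (γ.toFun 0) q
    have h2 := dist_triangle (g z) (γ.toFun 0) q
    show dist z (γ.toFun 0) - dist (g z) (γ.toFun 0) ≤ A + 2 * D
    linarith
  have : (approach γ.endpoint ⊓ 𝓟 T).NeBot := frequently_mem_iff_neBot.1 hT
  have hTl : ∀ᶠ z in approach γ.endpoint ⊓ 𝓟 T,
      dist z (γ.toFun 0) - dist (g z) (γ.toFun 0) ≤ A + 2 * D :=
    mem_inf_of_right (mem_principal_self T)
  have hl : Tendsto id (approach γ.endpoint ⊓ 𝓟 T) (approach γ.endpoint) := inf_le_left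
  -- On `T` the distance to the origin drops by a bounded amount, and `β` rises by at most `B`, so
  -- `g` preserves convergence to the endpoint.
  have hgl : Tendsto g (approach γ.endpoint ⊓ 𝓟 T) (approach γ.endpoint) := by
    rw [tendsto_approach_iff hg hδ0 hδ] at hl ⊢
    refine tendsto_atTop_mono' _ ?_ (tendsto_atTop_add_const_right _ (-(A + 2 * D + B)) hl)
    filter_upwards [hTl] with z hz
    have := hB z
    simp only [id]
    linarith
  have := hS (A + 2 * D + 12 * δ) fun z => by
    have := busemann_map_le hg hδ0 hδ γ hLip inf_le_left hgl hTl z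
    linarith
  rw [EReal.coe_lt_coe_iff] at hA2
  linarith

theorem hasGeodesicLimit_of_busemann_map_le {δ : ℝ} (hg : IsGeodesicSpace X) (hδ0 : 0 < δ)
    (hδ : IsDeltaHyperbolic X δ) {g : X → X} {η : GromovBoundary X}
    (hB : ∀ γ : GeodesicRay X, γ.endpoint = η →
      ∃ B, ∀ z, γ.busemann (g z) - γ.busemann z ≤ B) :
    HasGeodesicLimit (fun z => ofPoint (g z)) η (ofBoundary η) := by
  rintro u hu ⟨γ, R, rfl, hR, hmem⟩
  obtain ⟨B, hB⟩ := hB γ rfl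
  have hu' : Tendsto u atTop (approach γ.endpoint) := tendsto_comap_iff.2 hu
  suffices h : Tendsto (fun n => g (u n)) atTop (approach γ.endpoint) from tendsto_comap_iff.1 h
  rw [tendsto_approach_iff hg hδ0 hδ] at hu' ⊢
  -- Near the ray, `-β(u)` is comparable to `d(u,p)`, and `d(g u,p) - β(g u) ≥ -2β(g u)`; the
  -- constant has slack.
  refine tendsto_atTop_mono (fun n => ?_)
    (tendsto_atTop_add_const_right _ (-(4 * R + 2 * B)) hu')
  obtain ⟨_, ⟨t, rfl⟩, ht⟩ := Metric.mem_thickening_iff.1 (hmem n)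
  have h1 := hB (u n)
  have h2 := γ.neg_dist_le_busemann (g (u n))
  have h3 := γ.busemann_le_add_dist (u n) (γ.toFun t)
  have h4 := dist_triangle (u n) (γ.toFun t) (γ.toFun 0)
  rw [dist_comm (γ.toFun t) (γ.toFun 0), γ.dist_zero_apply] at h4
  rw [γ.busemann_apply] at h3
  linarith

end Busemann

/-! ### Backward orbits and their step rates -/

section BackwardOrbit

variable {X : Type*}

theorem IsBackwardOrbit.iterate_apply {f : X → X} {x : ℕ → X} (hx : IsBackwardOrbit f x)
    (m n : ℕ) : f^[m] (x (n + m)) = x n := by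
  induction m with
  | zero => rfl
  | succ m ih => rw [Function.iterate_succ_apply, ← add_assoc, hx, ih]

variable [MetricSpace X]

theorem dist_add_le_mul {x : ℕ → X} {K : ℝ} (hK : ∀ n, dist (x (n + 1)) (x n) ≤ K) (m n : ℕ) :
    dist (x (n + m)) (x n) ≤ m * K := by
  induction m with
  | zero => simp
  | succ m ih =>
    have h1 := dist_triangle (x (n + m + 1)) (x (n + m)) (x n)
    have h2 := hK (n + m)
    push_cast
    rw [← add_assoc]
    linarith

/-- The limits `σ_m` exist and bound the steps from above, and the rate exists. -/
theorem IsBackwardOrbit.exists_backwardStepRate {f : X → X} (hf : LipschitzWith 1 f) {x : ℕ → X}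
    (hx : IsBackwardOrbit f x) (hstep : HasBoundedStep x) :
    ∃ (σ : ℕ → ℝ) (b : ℝ), (∀ m, Tendsto (fun n => dist (x (n + m)) (x n)) atTop (𝓝 (σ m))) ∧
      (∀ m n, dist (x (n + m)) (x n) ≤ σ m) ∧ Tendsto (fun m : ℕ => σ m / m) atTop (𝓝 b) := by
  obtain ⟨K, hK⟩ := hstep
  -- Applying `f` shifts both indices down by one without increasing the distance.
  have hmono : ∀ m, Monotone fun n => dist (x (n + m)) (x n) := fun m =>
    monotone_nat_of_le_succ fun n => by
      have := hf.dist_le_mul (x (n + 1 + m)) (x (n + 1))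
      rw [add_right_comm, hx, hx, NNReal.coe_one, one_mul, add_right_comm] at this
      exact this
  have hbdd : ∀ m, BddAbove (Set.range fun n => dist (x (n + m)) (x n)) := fun m =>
    ⟨m * K, by rintro _ ⟨n, rfl⟩; exact dist_add_le_mul hK m n⟩
  let σ : ℕ → ℝ := fun m => ⨆ n, dist (x (n + m)) (x n)
  have hle : ∀ m n, dist (x (n + m)) (x n) ≤ σ m := fun m n => le_ciSup (hbdd m) n
  have hσ0 : ∀ m, 0 ≤ σ m := fun m => dist_nonneg.trans (hle m 0)
  have hsub : Subadditive σ := fun m k => ciSup_le fun n => by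
    have h1 := dist_triangle (x (n + (m + k))) (x (n + m)) (x n)
    have h2 := hle k (n + m)
    have h3 := hle m n
    rw [add_assoc] at h2
    linarith
  refine ⟨σ, hsub.lim, fun m => tendsto_atTop_ciSup (hmono m) (hbdd m), hle,
    hsub.tendsto_lim ⟨0, ?_⟩⟩
  rintro _ ⟨n, rfl⟩
  exact div_nonneg (hσ0 n) n.cast_nonneg

/-- If the Busemann function drops by at least `6δ` at each application of `g`, then backward
orbits of `g` with bounded step stay away from the centre of the Busemann function. -/
theorem dist_add_busemann_sub_le {δ : ℝ} (hg : IsGeodesicSpace X)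
    (hδ : IsDeltaHyperbolic X δ) (hδ0 : 0 < δ) (γ : GeodesicRay X) {y : ℕ → X} {M : ℝ}
    (hM : ∀ n, dist (y (n + 1)) (y n) ≤ M)
    (hy : ∀ n, γ.busemann (y n) + 6 * δ ≤ γ.busemann (y (n + 1))) (k j : ℕ) :
    dist (y j) (y (j + k)) + γ.busemann (y j) - γ.busemann (y (j + k)) ≤ M := by
  induction k generalizing j with
  | zero => simpa using dist_nonneg.trans (hM 0)
  | succ k ih =>
    have h1 := ih (j + 1)
    rw [show j + 1 + k = j + (k + 1) by ring] at h1
    have h2 := γ.busemann_fourPoint hg hδ (y j) (y (j + (k + 1))) (y (j + 1))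
    have h3 := hM j
    have h4 := hy j
    rw [dist_comm] at h3
    rw [dist_comm (y (j + 1))] at h1
    -- The gap in `hy` absorbs the four-point error in either branch, so `M` does not grow with `k`.
    rcases le_max_iff.1 (sub_le_iff_le_add.2 h2) with h | h <;> linarith

end BackwardOrbit

/-! ### Stable dilation as the growth rate of the Busemann increase -/

section StableDilation

variable {X : Type*} [MetricSpace X]

theorem lipschitzWith_one_iterate {f : X → X} (hf : LipschitzWith 1 f) (n : ℕ) :
    LipschitzWith 1 f^[n] := by
  simpa using hf.iterate n

theorem dist_iterate_le_mul {f : X → X} (hf : LipschitzWith 1 f) (p : X) (n : ℕ) :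
    dist (f^[n] p) p ≤ n * dist (f p) p := by
  induction n with
  | zero => simp
  | succ n ih =>
    have h1 := dist_triangle (f^[n] (f p)) (f^[n] p) p
    have h2 := (lipschitzWith_one_iterate hf n).dist_le_mul (f p) p
    rw [NNReal.coe_one, one_mul] at h2
    rw [Function.iterate_succ_apply]
    push_cast
    linarith

/-- The largest increase of the Busemann function of `γ` under `f^n`. -/
noncomputable def busemannIncrease (γ : GeodesicRay X) (f : X → X) (n : ℕ) : ℝ :=
  ⨆ z, (γ.busemann (f^[n] z) - γ.busemann z)

variable {γ : GeodesicRay X} {f : X → X}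

theorem le_busemannIncrease
    (hbdd : ∀ n, ∃ B, ∀ z, γ.busemann (f^[n] z) - γ.busemann z ≤ B) (n : ℕ) (z : X) :
    γ.busemann (f^[n] z) - γ.busemann z ≤ busemannIncrease γ f n := by
  obtain ⟨B, hB⟩ := hbdd n
  exact le_ciSup (f := fun z => γ.busemann (f^[n] z) - γ.busemann z)
    ⟨B, by rintro _ ⟨z, rfl⟩; exact hB z⟩ z

theorem busemannIncrease_le {n : ℕ} {B : ℝ}
    (hB : ∀ z, γ.busemann (f^[n] z) - γ.busemann z ≤ B) : busemannIncrease γ f n ≤ B :=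
  have : Nonempty X := ⟨γ.toFun 0⟩
  ciSup_le hB

theorem tendsto_busemannIncrease_div (hf : LipschitzWith 1 f)
    (hbdd : ∀ n, ∃ B, ∀ z, γ.busemann (f^[n] z) - γ.busemann z ≤ B) :
    ∃ L, Tendsto (fun n : ℕ => busemannIncrease γ f n / n) atTop (𝓝 L) := by
  have hsub : Subadditive (busemannIncrease γ f) := fun m n => busemannIncrease_le fun z => by
    have h1 := le_busemannIncrease hbdd n z
    have h2 := le_busemannIncrease hbdd m (f^[n] z)
    rw [Function.iterate_add_apply]
    linarith
  -- The orbit of the origin escapes at most linearly, which bounds the quotients below and makes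
  -- the limit finite.
  refine ⟨_, hsub.tendsto_lim ⟨-dist (f (γ.toFun 0)) (γ.toFun 0), ?_⟩⟩
  rintro _ ⟨n, rfl⟩
  rcases n.eq_zero_or_pos with rfl | hn
  · simp
  · rw [le_div_iff₀ (by exact_mod_cast hn)]
    have h1 := le_busemannIncrease hbdd n (γ.toFun 0)
    have h2 := γ.neg_dist_le_busemann (f^[n] (γ.toFun 0))
    have h3 := dist_iterate_le_mul hf (γ.toFun 0) n
    rw [γ.busemann_zero] at h1
    linarith

/-- The errors in `logDilation_le` and `le_logDilation` do not depend on `n`, so they vanish after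
division by `n`. -/
theorem hasLogStableDilation_of_tendsto {δ : ℝ} (hg : IsGeodesicSpace X) (hδ0 : 0 < δ)
    (hδ : IsDeltaHyperbolic X δ) (hf : LipschitzWith 1 f)
    (hbdd : ∀ n, ∃ B, ∀ z, γ.busemann (f^[n] z) - γ.busemann z ≤ B) {L : ℝ}
    (hL : Tendsto (fun n : ℕ => busemannIncrease γ f n / n) atTop (𝓝 L)) :
    HasLogStableDilation f γ.endpoint L := by
  intro q
  have key : ∀ c : ℝ, Tendsto (fun n : ℕ => (((busemannIncrease γ f n + c) / n : ℝ) : EReal)) atTop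
      (𝓝 (L : EReal)) := fun c => by
    refine (continuous_coe_real_ereal.tendsto L).comp ?_
    simpa [add_div] using hL.add (tendsto_const_div_atTop_nhds_zero_nat c)
  have hcoe : ∀ (a : ℝ) (n : ℕ), ((a / n : ℝ) : EReal) = (a : EReal) / (n : EReal) := fun a n => by
    rw [EReal.coe_div]; rfl
  refine tendsto_of_tendsto_of_tendsto_of_le_of_le
    (key (-(12 * δ + 2 * dist (γ.toFun 0) q))) (key (2 * dist (γ.toFun 0) q))
    (fun n => ?_) fun n => ?_
  · simp only [hcoe]
    refine EReal.div_le_div_right_of_nonneg (Nat.cast_nonneg' n) ?_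
    rw [← sub_eq_add_neg]
    exact le_logDilation hg hδ0 hδ γ (lipschitzWith_one_iterate hf n)
      (le_busemannIncrease hbdd n) (fun B' hB' => busemannIncrease_le hB') q
  · simp only [hcoe]
    exact EReal.div_le_div_right_of_nonneg (Nat.cast_nonneg' n)
      (logDilation_le hg hδ0 hδ γ (le_busemannIncrease hbdd n) q)

/-- Along a backward orbit accumulating at the endpoint of `γ`, the Busemann function of `γ`
increases under `f^m` by at most a bound for the `m`-steps of the orbit, up to a constant. -/
theorem IsBackwardOrbit.busemann_iterate_le {δ : ℝ} (hg : IsGeodesicSpace X) (hδ0 : 0 < δ)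
    (hδ : IsDeltaHyperbolic X δ) (hf : LipschitzWith 1 f) {x : ℕ → X} (hx : IsBackwardOrbit f x)
    (hη : IsBoundaryLimitPoint x γ.endpoint) {m : ℕ} {A : ℝ}
    (hA : ∀ n, dist (x (n + m)) (x n) ≤ A) (z : X) :
    γ.busemann (f^[m] z) - γ.busemann z ≤ A + 12 * δ := by
  obtain ⟨φ, hφ, hlim⟩ := hη
  have hlim' : Tendsto (fun k => x (φ k)) atTop (approach γ.endpoint) := tendsto_comap_iff.2 hlim
  -- Once `φ k ≥ m`, the image is `x (φ k - m)`.
  have hdist : ∀ᶠ k in atTop, dist (x (φ k)) (f^[m] (x (φ k))) ≤ A := by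
    filter_upwards [eventually_ge_atTop m] with k hk
    obtain ⟨n, hn⟩ := Nat.exists_eq_add_of_le' (hk.trans (hφ.id_le k))
    rw [hn, hx.iterate_apply]
    exact hA n
  have hmap : Tendsto (fun k => f^[m] (x (φ k))) atTop (approach γ.endpoint) := by
    rw [tendsto_approach_iff hg hδ0 hδ] at hlim' ⊢
    refine tendsto_atTop_mono' _ ?_ (tendsto_atTop_add_const_right _ (-(2 * A)) hlim')
    filter_upwards [hdist] with k hk
    have h1 := dist_triangle (x (φ k)) (f^[m] (x (φ k))) (γ.toFun 0)
    have h2 := γ.busemann_le_add_dist (f^[m] (x (φ k))) (x (φ k))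
    rw [dist_comm (f^[m] _)] at h2
    linarith
  have := busemann_map_le hg hδ0 hδ γ (lipschitzWith_one_iterate hf m)
    (l := map (fun k => x (φ k)) atTop) hlim' (tendsto_map'_iff.2 hmap) (A := A)
    (eventually_map.2 <| hdist.mono fun k hk => by
      have := dist_triangle (x (φ k)) (f^[m] (x (φ k))) (γ.toFun 0)
      linarith) z
  linarith

/-- The Busemann function of `γ` cannot decrease linearly under iteration if a backward orbit
with bounded step accumulates at the endpoint of `γ`. -/
theorem IsBackwardOrbit.nonneg_of_tendsto {δ : ℝ} (hg : IsGeodesicSpace X) (hδ0 : 0 < δ)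
    (hδ : IsDeltaHyperbolic X δ) {x : ℕ → X} (hx : IsBackwardOrbit f x) (hstep : HasBoundedStep x)
    (hη : IsBoundaryLimitPoint x γ.endpoint)
    (hbdd : ∀ n, ∃ B, ∀ z, γ.busemann (f^[n] z) - γ.busemann z ≤ B) {L : ℝ}
    (hL : Tendsto (fun n : ℕ => busemannIncrease γ f n / n) atTop (𝓝 L)) : 0 ≤ L := by
  by_contra! hneg
  obtain ⟨K, hK⟩ := hstep
  obtain ⟨N, hN1, hN⟩ : ∃ N : ℕ, 0 < N ∧ busemannIncrease γ f N ≤ -(6 * δ) := by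
    have h1 : Tendsto (fun n : ℕ => busemannIncrease γ f n / n * n) atTop atBot :=
      hL.neg_mul_atTop hneg tendsto_natCast_atTop_atTop
    obtain ⟨N, hN, hN1⟩ :=
      ((h1.eventually_le_atBot (-(6 * δ))).and (eventually_gt_atTop 0)).exists
    refine ⟨N, hN1, ?_⟩
    rwa [div_mul_cancel₀ _ (by positivity)] at hN
  -- Every `N`-th point forms a backward orbit of `f^N`, along which the Busemann function rises by
  -- at least `6δ`.
  have hbound := dist_add_busemann_sub_le hg hδ hδ0 γ (y := fun j => x (N * j)) (M := N * K)
    (fun j => by simpa only [mul_add, mul_one] using dist_add_le_mul hK N (N * j))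
    (fun j => by
      have := le_busemannIncrease hbdd N (x (N * j + N))
      rw [hx.iterate_apply] at this
      rw [mul_add, mul_one]
      linarith)
  have hK0 : 0 ≤ K := dist_nonneg.trans (hK 0)
  obtain ⟨φ, hφ, hlim⟩ := hη
  have hlim' : Tendsto (fun k => x (φ k)) atTop (approach γ.endpoint) := tendsto_comap_iff.2 hlim
  rw [tendsto_approach_iff hg hδ0 hδ] at hlim'
  -- The threshold combines the bound `hbound` from `x 0` with twice `N * K`, for rounding `φ k`
  -- down to a multiple of `N`.
  obtain ⟨k, hk⟩ := (hlim'.eventually_gt_atTop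
    (N * K - γ.busemann (x 0) + dist (x 0) (γ.toFun 0) + 2 * (N * K))).exists
  have h1 := hbound (φ k / N) 0
  simp only [mul_zero, zero_add] at h1
  have h2 := dist_add_le_mul hK (φ k % N) (N * (φ k / N))
  rw [Nat.div_add_mod] at h2
  have h3 : ((φ k % N : ℕ) : ℝ) * K ≤ N * K :=
    mul_le_mul_of_nonneg_right (by exact_mod_cast (Nat.mod_lt _ hN1).le) hK0
  have h5 := γ.busemann_le_add_dist (x (N * (φ k / N))) (x (φ k))
  have h6 := dist_triangle (x (φ k)) (x (N * (φ k / N))) (γ.toFun 0)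
  have h7 := dist_triangle_left (x (N * (φ k / N))) (γ.toFun 0) (x 0)
  rw [dist_comm (x (N * (φ k / N))) (x (φ k))] at h5
  linarith

end StableDilation

end GromovDynamics

theorem mainTheorem12 {X : Type*} [MetricSpace X] [ProperSpace X]
    (hgeo : GromovDynamics.IsGeodesicSpace X) (hhyp : GromovDynamics.IsGromovHyperbolic X)
    (f : X → X) (hf : LipschitzWith 1 f)
    (x : ℕ → X) (hx : GromovDynamics.IsBackwardOrbit f x) (hstep : GromovDynamics.HasBoundedStep x)
    (η : GromovDynamics.GromovBoundary X) (hη : GromovDynamics.IsBoundaryLimitPoint x η) :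
    GromovDynamics.IsBRFP f η ∧
      ∃ L b : ℝ, GromovDynamics.HasLogStableDilation f η L ∧
        GromovDynamics.HasBackwardStepRate x b ∧ 0 ≤ L ∧ L ≤ b := by
  obtain ⟨δ, hδ0, hδ⟩ := hhyp
  obtain ⟨σ, b, hσ, hle, hb⟩ := hx.exists_backwardStepRate hf hstep
  have hinc : ∀ γ : GromovDynamics.GeodesicRay X, γ.endpoint = η → ∀ n z,
      γ.busemann (f^[n] z) - γ.busemann z ≤ σ n + 12 * δ := by
    rintro γ rfl n z
    exact hx.busemann_iterate_le hgeo hδ0 hδ hf hη (hle n) z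
  obtain ⟨γ, rfl⟩ : ∃ γ : GromovDynamics.GeodesicRay X, γ.endpoint = η :=
    Quotient.exists_rep (s := GromovDynamics.GeodesicRay.setoid X) η
  have hbdd : ∀ n, ∃ B, ∀ z, γ.busemann (f^[n] z) - γ.busemann z ≤ B :=
    fun n => ⟨_, hinc γ rfl n⟩
  obtain ⟨L, hL⟩ := GromovDynamics.tendsto_busemannIncrease_div hf hbdd
  refine ⟨⟨fun p => ?_, ?_⟩, L, b,
    GromovDynamics.hasLogStableDilation_of_tendsto hgeo hδ0 hδ hf hbdd hL,
    ⟨σ, fun m _ => hσ m, hb⟩, hx.nonneg_of_tendsto hgeo hδ0 hδ hstep hη hbdd hL, ?_⟩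
  · exact (GromovDynamics.logDilation_le hgeo hδ0 hδ γ (hinc γ rfl 1) p).trans_lt
      (EReal.coe_lt_top _)
  · exact GromovDynamics.hasGeodesicLimit_of_busemann_map_le hgeo hδ0 hδ
      fun γ' hγ' => ⟨_, hinc γ' hγ' 1⟩
  · have hb' := hb.add (tendsto_const_div_atTop_nhds_zero_nat (12 * δ))
    rw [add_zero] at hb'
    refine le_of_tendsto_of_tendsto' hL hb' fun n => ?_
    rw [← add_div]
    exact div_le_div_of_nonneg_right (GromovDynamics.busemannIncrease_le (hinc γ rfl n))
      n.cast_nonneg
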